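/- Let $K\ge 0$ and $d_1,\dots,d_K\ge 1$, and let $(X_i,A_i,R_i)$, $i=1,2,\dots$, be i.i.d. copies of $(X,A,R)$, where $X$ is a random context, $A=(A_1,\dots,A_K)\in\prod_{k=1}^K[d_k]$ is drawn from a factored logging policy $\mu(a\mid x)=\prod_{k=1}^K\mu_k(a_k\mid x)$ given $X=x$, and $R$ is a real reward drawn from a conditional law given $(A,X)$. Let $\pi(a\mid x)$ be a fixed target policy with slot marginals $\pi(a_k\mid x)$, such that for almost every $x$ and all $k$ and $a_k$, $\mu_k(a_k\mid x)=0$ implies $\pi(a_k\mid x)=0$. Put $$Y_k=\frac{\pi(A_k\mid X)}{\mu_k(A_k\mid X)},\qquad G=1+\sum_{k=1}^K(Y_k-1),\qquad \theta=\mathbb E[GR],$$ and assume that $GR$ and $Y_1,\dots,Y_K$ have finite second moments. For $w\in\mathbb R^K$ let $$\Gamma_w=GR-\sum_{k=1}^K w_k(Y_k-1),\qquad V_w=\operatorname{Var}(\Gamma_w),\qquad \hat\theta_n^{(w)}=\frac1n\sum_{i=1}^n\Gamma_{w,i},$$ where $\Gamma_{w,i}$ is $\Gamma_w$ evaluated at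 $(X_i,A_i,R_i)$. Let $\hat w_n$ be random vectors in $\mathbb R^K$, defined on the same probability space as the data (and possibly depending on the data), such that $\hat w_n\to w$ in probability for some fixed $w\in\mathbb R^K$. Then $$\sqrt n\,\bigl(\hat\theta_n^{(\hat w_n)}-\theta\bigr)\to_d \mathcal N(0,V_w).$$ -/

import Mathlib

open MeasureTheory ProbabilityTheory Filter
open scoped Topology

namespace SlateOPE

/-- A slate: one action in `{1, …, d k}` for each slot `k`. -/
abbrev Slate {K : ℕ} (d : Fin K → ℕ) : Type := (k : Fin K) → Fin (d k)

/-- One observation: context, slate, reward, nested as `((x, a), r)`. -/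
abbrev Obs (𝒳 : Type*) {K : ℕ} (d : Fin K → ℕ) : Type _ := (𝒳 × Slate d) × ℝ

section

variable {𝒳 : Type*} [MeasurableSpace 𝒳] {K : ℕ} {d : Fin K → ℕ}

/-- The law of a generic draw `(X, A, R)`: `X ∼ PX`, `A ∼ μ(· ∣ X)`, `R ∼ ρ(· ∣ X, A)`. -/
noncomputable def logLaw (PX : Measure 𝒳) (μ : Kernel 𝒳 (Slate d))
    (ρ : Kernel (𝒳 × Slate d) ℝ) : Measure (Obs 𝒳 d) :=
  (PX.compProd μ).compProd ρ

/-- The policy `μ` is factored with slot policies `μs`: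
`μ(a ∣ x) = ∏ k, μs k (a k ∣ x)`. -/
def IsFactored (μ : Kernel 𝒳 (Slate d)) (μs : (k : Fin K) → Kernel 𝒳 (Fin (d k))) : Prop :=
  ∀ (x : 𝒳) (a : Slate d), μ x {a} = ∏ k, μs k x {a k}

/-- The marginal probability `π(a_k ∣ x)` that the policy `π` takes action `b` in slot `k`. -/
noncomputable def slotProb (π : Kernel 𝒳 (Slate d)) (k : Fin K) (x : 𝒳) (b : Fin (d k)) : ℝ :=
  (π x).real {a | a k = b}

/-- Slot-wise coverage: for almost every context, an action that the slot policy never takes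
has probability zero in that slot under the target policy `π`. -/
def SlotCoverage (PX : Measure 𝒳) (π : Kernel 𝒳 (Slate d))
    (μs : (k : Fin K) → Kernel 𝒳 (Fin (d k))) : Prop :=
  ∀ᵐ x ∂PX, ∀ (k : Fin K) (b : Fin (d k)), (μs k x).real {b} = 0 → slotProb π k x b = 0

/-- The slot-level density ratio `Y_k = π(A_k ∣ X) / μ_k(A_k ∣ X)`. -/
noncomputable def Y (π : Kernel 𝒳 (Slate d)) (μs : (k : Fin K) → Kernel 𝒳 (Fin (d k)))
    (k : Fin K) (z : Obs 𝒳 d) : ℝ :=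
  slotProb π k z.1.1 (z.1.2 k) / (μs k z.1.1).real {z.1.2 k}

/-- `G = 1 + ∑ k, (Y_k - 1)`. -/
noncomputable def G (π : Kernel 𝒳 (Slate d)) (μs : (k : Fin K) → Kernel 𝒳 (Fin (d k)))
    (z : Obs 𝒳 d) : ℝ :=
  1 + ∑ k, (Y π μs k z - 1)

/-- The product `G R`. -/
noncomputable def GR (π : Kernel 𝒳 (Slate d)) (μs : (k : Fin K) → Kernel 𝒳 (Fin (d k)))
    (z : Obs 𝒳 d) : ℝ :=
  G π μs z * z.2

/-- `Γ_w = G R - ∑ k, w_k (Y_k - 1)`. -/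
noncomputable def Gam (π : Kernel 𝒳 (Slate d)) (μs : (k : Fin K) → Kernel 𝒳 (Fin (d k)))
    (w : Fin K → ℝ) (z : Obs 𝒳 d) : ℝ :=
  GR π μs z - ∑ k, w k * (Y π μs k z - 1)

/-- The target parameter `θ = E[G R]`, under the law `D` of a generic draw. -/
noncomputable def theta (π : Kernel 𝒳 (Slate d)) (μs : (k : Fin K) → Kernel 𝒳 (Fin (d k)))
    (D : Measure (Obs 𝒳 d)) : ℝ :=
  ∫ z, GR π μs z ∂D

/-- The variance `V_w = Var(Γ_w)`, under the law `D` of a generic draw. -/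
noncomputable def V (π : Kernel 𝒳 (Slate d)) (μs : (k : Fin K) → Kernel 𝒳 (Fin (d k)))
    (D : Measure (Obs 𝒳 d)) (w : Fin K → ℝ) : ℝ :=
  variance (Gam π μs w) D

/-- The empirical mean `E_n[f] = (1/n) ∑_{i < n} f(z_i)`. -/
noncomputable def empMean (n : ℕ) (z : ℕ → Obs 𝒳 d) (f : Obs 𝒳 d → ℝ) : ℝ :=
  (1 / (n : ℝ)) * ∑ i ∈ Finset.range n, f (z i)

/-- The control-variate estimator `θ̂_n^{(w)} = E_n[Γ_w]` computed from the data `z`. -/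
noncomputable def thetaHat (π : Kernel 𝒳 (Slate d))
    (μs : (k : Fin K) → Kernel 𝒳 (Fin (d k)))
    (n : ℕ) (z : ℕ → Obs 𝒳 d) (w : Fin K → ℝ) : ℝ :=
  empMean n z (Gam π μs w)

end

end SlateOPE

/-! ### Slutsky-type facts for real sequences. -/

namespace MeasureTheory

variable {Ω Ω' : Type*} {mΩ : MeasurableSpace Ω} {mΩ' : MeasurableSpace Ω'}
  {P : Measure Ω}

/-! The estimator is affine in its weights, so for `n ≥ 1`, however `ŵ` depends on the data,
√n(θ̂^(ŵ) − θ) = √n(θ̂^(w) − θ) + ∑ₖ √n(Eₙ[Yₖ] − 1)(wₖ − ŵₖ) (`thetaHat_sub_thetaHat`). Since E[Yₖ]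
= 1 (`integral_Y`), Γ_w has mean θ, and the classical CLT sends the first term to N(0, V_w). The
same CLT makes each √n(Eₙ[Yₖ] − 1) converge in distribution; multiplied by wₖ − ŵₖ → 0 it vanishes
in probability, and Slutsky discards the sum. -/

/-- Each coordinate of a sequence of random vectors that converges in probability does so. -/
theorem TendstoInMeasure.apply_sub {ι : Type*} [Fintype ι] {W : ℕ → Ω → ι → ℝ} {w : ι → ℝ}
    (h : TendstoInMeasure P W atTop (fun _ => w)) (i : ι) :
    TendstoInMeasure P (fun n ω => w i - W n ω i) atTop (fun _ => 0) := by
  rw [tendstoInMeasure_iff_norm] at h ⊢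
  intro ε hε
  refine tendsto_of_tendsto_of_tendsto_of_le_of_le tendsto_const_nhds (h ε hε)
    (fun _ => zero_le) fun n => measure_mono fun ω hω => ?_
  simp only [Set.mem_ofPred_eq, sub_zero] at hω ⊢
  rw [norm_sub_rev] at hω
  exact hω.trans (norm_le_pi_norm (W n ω - w) i)

variable [IsProbabilityMeasure P] {P' : Measure Ω'} [IsProbabilityMeasure P']

/-- Convergence in distribution to a constant implies convergence in probability. -/
theorem TendstoInDistribution.tendstoInMeasure_const {S : ℕ → Ω → ℝ} {c : ℝ}
    (h : TendstoInDistribution S atTop (fun _ : Ω' => c) (fun _ => P) P') :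
    TendstoInMeasure P S atTop (fun _ => c) := by
  rw [tendstoInMeasure_iff_norm]
  intro ε hε
  have hclosed : IsClosed {x : ℝ | ε ≤ ‖x - c‖} :=
    isClosed_le continuous_const (by fun_prop)
  -- Portmanteau: the limsup is at most the mass that the point mass at `c` gives to this closed
  -- set, namely 0.
  have hlim := ProbabilityMeasure.limsup_measure_closed_le_of_tendsto h.tendsto hclosed
  have hmap (n : ℕ) : (P.map (S n)) {x : ℝ | ε ≤ ‖x - c‖} = P {ω | ε ≤ ‖S n ω - c‖} :=
    Measure.map_apply_of_aemeasurable (h.forall_aemeasurable n) hclosed.measurableSet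
  have hzero : (P'.map (fun _ : Ω' => c)) {x : ℝ | ε ≤ ‖x - c‖} = 0 := by
    rw [Measure.map_apply measurable_const hclosed.measurableSet]
    simp [hε.not_ge]
  simp only [ProbabilityMeasure.coe_mk, hmap, hzero] at hlim
  exact tendsto_of_le_liminf_of_limsup_le (by simp) hlim

/-- A sequence that converges in distribution, multiplied by one that converges to zero in
probability, converges to zero in probability. -/
theorem TendstoInDistribution.mul_tendstoInMeasure_zero {T D : ℕ → Ω → ℝ} {Z : Ω' → ℝ}
    (hT : TendstoInDistribution T atTop Z (fun _ => P) P')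
    (hD : TendstoInMeasure P D atTop (fun _ => 0)) (hDm : ∀ n, AEMeasurable (D n) P) :
    TendstoInMeasure P (fun n ω => T n ω * D n ω) atTop (fun _ => 0) := by
  have h := hT.continuous_comp_prodMk_of_tendstoInMeasure_const
    (g := fun x : ℝ × ℝ => x.1 * x.2) (by fun_prop) hD hDm
  simp only [mul_zero] at h
  exact h.tendstoInMeasure_const

/-- Adding finitely many sequences that converge to zero in probability does not change a limit
in distribution. -/
theorem TendstoInDistribution.add_sum_of_tendstoInMeasure_zero {ι : Type*} {T : ℕ → Ω → ℝ}
    {S : ι → ℕ → Ω → ℝ} {Z : Ω' → ℝ} (s : Finset ι)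
    (hT : TendstoInDistribution T atTop Z (fun _ => P) P')
    (hS : ∀ i, TendstoInMeasure P (S i) atTop (fun _ => 0))
    (hSm : ∀ i n, AEMeasurable (S i n) P) :
    TendstoInDistribution (fun n ω => T n ω + ∑ i ∈ s, S i n ω) atTop Z (fun _ => P) P' := by
  classical
  induction s using Finset.induction_on with
  | empty => simpa using hT
  | insert i s hi ih =>
    have h := ih.add_of_tendstoInMeasure_const (hS i) (hSm i)
    simp only [add_zero] at h
    convert! h using 3 with n ω
    simp only [Pi.add_apply, Finset.sum_insert hi]
    ring

end MeasureTheory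

/-! ### Central limit theorem for empirical means. -/

namespace SlateOPE

variable {𝒳 : Type*} [MeasurableSpace 𝒳] {K : ℕ} {d : Fin K → ℕ}

instance (PX : Measure 𝒳) [IsProbabilityMeasure PX] (μ : Kernel 𝒳 (Slate d)) [IsMarkovKernel μ]
    (ρ : Kernel (𝒳 × Slate d) ℝ) [IsMarkovKernel ρ] : IsProbabilityMeasure (logLaw PX μ ρ) := by
  unfold logLaw; infer_instance

/-- The central limit theorem for the empirical means of an iid sequence. -/
theorem tendstoInDistribution_empMean {Ω : Type*} [MeasurableSpace Ω] {P : Measure Ω}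
    [IsProbabilityMeasure P] {D : Measure (Obs 𝒳 d)} {z : ℕ → Ω → Obs 𝒳 d}
    (hindep : iIndepFun z P) (hlaw : ∀ i, HasLaw (z i) D P) {f : Obs 𝒳 d → ℝ}
    (hf : Measurable f) (hf2 : MemLp f 2 D) :
    TendstoInDistribution
      (fun (n : ℕ) ω => Real.sqrt n * (empMean n (fun i => z i ω) f - ∫ x, f x ∂D))
      atTop (id : ℝ → ℝ) (fun _ => P) (gaussianReal 0 (variance f D).toNNReal) := by
  have hmap (i : ℕ) : P.map (z i) = D := (hlaw i).map_eq
  have hident (i : ℕ) : IdentDistrib (fun ω => f (z i ω)) (fun ω => f (z 0 ω)) P P :=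
    IdentDistrib.comp (u := f)
      ⟨(hlaw i).aemeasurable, (hlaw 0).aemeasurable, by rw [hmap, hmap]⟩ hf
  have hmean : ∫ ω, f (z 0 ω) ∂P = ∫ x, f x ∂D :=
    (hlaw 0).integral_comp hf.aestronglyMeasurable
  have hvar : variance (fun ω => f (z 0 ω)) P = variance f D := by
    rw [← hmap 0, variance_map hf.aemeasurable (hlaw 0).aemeasurable]
    rfl
  have hmem : MemLp (fun ω => f (z 0 ω)) 2 P := by
    rw [← hmap 0] at hf2
    exact hf2.comp_of_map (hlaw 0).aemeasurable
  have hgauss : HasLaw (id : ℝ → ℝ) (gaussianReal 0 (variance (fun ω => f (z 0 ω)) P).toNNReal)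
      (gaussianReal 0 (variance f D).toNNReal) := by
    rw [hvar]; exact HasLaw.id
  have h := tendstoInDistribution_inv_sqrt_mul_sum_sub (X := fun i ω => f (z i ω)) hgauss hmem
    (hindep.comp (fun _ => f) fun _ => hf) hident
  convert! h using 3 with n ω
  rw [hmean, empMean]
  rcases Nat.eq_zero_or_pos n with rfl | hn
  · simp
  · have hn' : (0 : ℝ) < n := by exact_mod_cast hn
    have hs := Real.mul_self_sqrt hn'.le
    have hs0 : Real.sqrt n ≠ 0 := (Real.sqrt_pos.2 hn').ne'
    field_simp
    rw [Real.sq_sqrt hn'.le]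

/-! ### Density ratios: measurability, means, and the effect of the weights. -/

section Ratio

variable (π : Kernel 𝒳 (Slate d)) (μs : (k : Fin K) → Kernel 𝒳 (Fin (d k)))

/-- The slot-level density ratio as a function of the context and of the action in the slot. -/
noncomputable def slotRatio (k : Fin K) (p : 𝒳 × Fin (d k)) : ℝ :=
  slotProb π k p.1 p.2 / (μs k p.1).real {p.2}

theorem measurable_slotRatio (k : Fin K) : Measurable (slotRatio π μs k) := by
  refine measurable_from_prod_countable_left fun b => ?_
  have h1 : Measurable fun x => π x {a | a k = b} :=
    π.measurable_coe ((measurableSet_singleton b).preimage (measurable_pi_apply k))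
  have h2 : Measurable fun x => μs k x {b} := (μs k).measurable_coe (measurableSet_singleton b)
  exact h1.ennreal_toReal.div h2.ennreal_toReal

theorem measurable_Y (k : Fin K) : Measurable (Y π μs k) := by
  have h := measurable_slotRatio π μs k
  exact h.comp (f := fun z : Obs 𝒳 d => (z.1.1, z.1.2 k)) (by fun_prop)

theorem measurable_GR : Measurable (GR π μs) := by
  have h := measurable_Y π μs
  unfold GR G
  fun_prop

theorem measurable_Gam (w : Fin K → ℝ) : Measurable (Gam π μs w) := by
  have h := measurable_Y π μs
  have h' := measurable_GR π μs
  unfold Gam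
  fun_prop

variable {π μs}

theorem sum_slotProb [IsMarkovKernel π] (k : Fin K) (x : 𝒳) : ∑ b, slotProb π k x b = 1 := by
  have h := sum_measureReal_preimage_singleton (μ := π x) (f := fun a : Slate d => a k)
    Finset.univ (fun b _ => measurable_pi_apply k (measurableSet_singleton b))
  simpa [slotProb, Set.preimage] using h

/-- On the finite slate space singletons determine a measure, so the factorization makes `μ x` a
product measure. -/
theorem IsFactored.map_eval {μ : Kernel 𝒳 (Slate d)} [∀ k, IsMarkovKernel (μs k)]
    (hfac : IsFactored μ μs) (x : 𝒳) (k : Fin K) :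
    (μ x).map (fun a => a k) = μs k x := by
  have h : μ x = Measure.pi fun k => μs k x :=
    Measure.ext_of_singleton fun a => by rw [hfac, Measure.pi_singleton]
  rw [h]
  exact (measurePreserving_eval (fun k => μs k x) k).map_eq

theorem integral_slotRatio [IsMarkovKernel π] [∀ k, IsMarkovKernel (μs k)] {x : 𝒳} {k : Fin K}
    (hx : ∀ b, (μs k x).real {b} = 0 → slotProb π k x b = 0) :
    ∫ b, slotRatio π μs k (x, b) ∂(μs k x) = 1 := by
  rw [integral_fintype (Integrable.of_finite), ← sum_slotProb (π := π) k x]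
  refine Finset.sum_congr rfl fun b _ => ?_
  -- A null action contributes 0 to the integral, and coverage makes its target probability 0 as
  -- well; otherwise the denominator cancels.
  by_cases hb : (μs k x).real {b} = 0
  · simp [hb, hx b hb]
  · simp only [slotRatio, smul_eq_mul]
    field_simp

/-- The reward integrates out; given the context, factorization leaves only slot `k`, where the
ratio has mean 1 by coverage, for almost every context. -/
theorem integral_Y [IsMarkovKernel π] [∀ k, IsMarkovKernel (μs k)]
    {PX : Measure 𝒳} [IsProbabilityMeasure PX] {μ : Kernel 𝒳 (Slate d)} [IsMarkovKernel μ]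
    (hfac : IsFactored μ μs) {ρ : Kernel (𝒳 × Slate d) ℝ} [IsMarkovKernel ρ]
    (hcov : SlotCoverage PX π μs) {k : Fin K} (hY : Integrable (Y π μs k) (logLaw PX μ ρ)) :
    ∫ z, Y π μs k z ∂(logLaw PX μ ρ) = 1 := by
  have hfst : (logLaw PX μ ρ).map Prod.fst = PX.compProd μ := Measure.fst_compProd _ _
  have hm := measurable_slotRatio π μs k
  have hf : Measurable fun p : 𝒳 × Slate d => slotRatio π μs k (p.1, p.2 k) :=
    hm.comp (by fun_prop)
  have hYf : Y π μs k = (fun p : 𝒳 × Slate d => slotRatio π μs k (p.1, p.2 k)) ∘ Prod.fst := rfl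
  have hint : Integrable (fun p : 𝒳 × Slate d => slotRatio π μs k (p.1, p.2 k))
      (PX.compProd μ) := by
    rw [← hfst, integrable_map_measure hf.aestronglyMeasurable measurable_fst.aemeasurable]
    exact hY
  calc ∫ z, Y π μs k z ∂(logLaw PX μ ρ)
      = ∫ p, slotRatio π μs k (p.1, p.2 k) ∂(PX.compProd μ) := by
        rw [← hfst, integral_map measurable_fst.aemeasurable hf.aestronglyMeasurable]
        rfl
    _ = ∫ x, ∫ a, slotRatio π μs k (x, a k) ∂(μ x) ∂PX := Measure.integral_compProd hint
    _ = ∫ _, 1 ∂PX := by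
        refine integral_congr_ae ?_
        filter_upwards [hcov] with x hx
        rw [← integral_slotRatio (hx k), ← hfac.map_eval x k,
          integral_map (measurable_pi_apply k).aemeasurable
            (hm.comp measurable_prodMk_left).aestronglyMeasurable]
    _ = 1 := by simp

theorem memLp_Gam {D : Measure (Obs 𝒳 d)} [IsProbabilityMeasure D]
    (hY : ∀ k, MemLp (Y π μs k) 2 D) (hGR : MemLp (GR π μs) 2 D) (w : Fin K → ℝ) :
    MemLp (Gam π μs w) 2 D :=
  hGR.sub (memLp_finsetSum _ fun k _ => ((hY k).sub (memLp_const 1)).const_mul (w k))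

theorem integral_Gam {D : Measure (Obs 𝒳 d)} [IsProbabilityMeasure D]
    (hY : ∀ k, Integrable (Y π μs k) D) (hGR : Integrable (GR π μs) D)
    (hmean : ∀ k, ∫ z, Y π μs k z ∂D = 1) (w : Fin K → ℝ) :
    ∫ z, Gam π μs w z ∂D = theta π μs D := by
  have hk (k : Fin K) : Integrable (fun z => w k * (Y π μs k z - 1)) D :=
    ((hY k).sub (integrable_const 1)).const_mul (w k)
  unfold Gam theta
  rw [integral_sub hGR (integrable_finsetSum _ fun k _ => hk k),
    integral_finsetSum _ fun k _ => hk k]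
  simp [integral_const_mul, integral_sub (hY _) (integrable_const 1), hmean]

/-- Changing the weights of the estimator changes it by a combination of the empirical means of
the density ratios. -/
theorem thetaHat_sub_thetaHat {n : ℕ} (hn : n ≠ 0) (z : ℕ → Obs 𝒳 d) (w w' : Fin K → ℝ) :
    thetaHat π μs n z w' - thetaHat π μs n z w =
      ∑ k, (empMean n z (Y π μs k) - 1) * (w k - w' k) := by
  have hn' : (n : ℝ) ≠ 0 := Nat.cast_ne_zero.2 hn
  have hmean (k : Fin K) : empMean n z (Y π μs k) - 1
      = (1 / (n : ℝ)) * ∑ i ∈ Finset.range n, (Y π μs k (z i) - 1) := by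
    simp only [empMean, Finset.sum_sub_distrib, Finset.sum_const, Finset.card_range, nsmul_eq_mul]
    field_simp
  simp only [hmean]
  simp only [thetaHat, empMean]
  rw [← mul_sub, ← Finset.sum_sub_distrib]
  simp only [mul_assoc, ← Finset.mul_sum, Finset.sum_mul]
  rw [Finset.sum_comm]
  congr 1
  refine Finset.sum_congr rfl fun i _ => ?_
  -- The `GR` terms cancel.
  rw [Gam, Gam, sub_sub_sub_cancel_left, ← Finset.sum_sub_distrib]
  exact Finset.sum_congr rfl fun k _ => by ring

end Ratio

end SlateOPE


/-! ### The limit theorem with random weights. -/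

theorem lemma3 {𝒳 : Type*} [MeasurableSpace 𝒳] {K : ℕ} {d : Fin K → ℕ}
    -- context law, logging policy with its slot policies, reward law, target policy
    (PX : Measure 𝒳) [IsProbabilityMeasure PX]
    (μ : Kernel 𝒳 (SlateOPE.Slate d)) [IsMarkovKernel μ]
    (μs : (k : Fin K) → Kernel 𝒳 (Fin (d k))) [∀ k, IsMarkovKernel (μs k)]
    (hfac : SlateOPE.IsFactored μ μs)
    (ρ : Kernel (𝒳 × SlateOPE.Slate d) ℝ) [IsMarkovKernel ρ]
    (π : Kernel 𝒳 (SlateOPE.Slate d)) [IsMarkovKernel π]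
    (hcov : SlateOPE.SlotCoverage PX π μs)
    -- finite second moments
    (hY : ∀ k, MemLp (SlateOPE.Y π μs k) 2 (SlateOPE.logLaw PX μ ρ))
    (hGR : MemLp (SlateOPE.GR π μs) 2 (SlateOPE.logLaw PX μ ρ))
    -- the iid data
    {Ω : Type*} [MeasurableSpace Ω] (P : Measure Ω) [IsProbabilityMeasure P]
    (X : ℕ → Ω → 𝒳) (A : ℕ → Ω → SlateOPE.Slate d) (R : ℕ → Ω → ℝ)
    (hindep : iIndepFun (fun i ω => ((X i ω, A i ω), R i ω)) P)
    (hlaw : ∀ i, HasLaw (fun ω => ((X i ω, A i ω), R i ω)) (SlateOPE.logLaw PX μ ρ) P)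
    -- the random weights and their limit in probability
    (what : ℕ → Ω → Fin K → ℝ) (hwhat : ∀ n, AEMeasurable (what n) P)
    (w : Fin K → ℝ) (hw : TendstoInMeasure P what atTop (fun _ => w)) :
    TendstoInDistribution
      (fun (n : ℕ) ω => Real.sqrt n *
        (SlateOPE.thetaHat π μs n (fun i => ((X i ω, A i ω), R i ω)) (what n ω)
          - SlateOPE.theta π μs (SlateOPE.logLaw PX μ ρ)))
      atTop (id : ℝ → ℝ) (fun _ => P)
      (gaussianReal 0 (SlateOPE.V π μs (SlateOPE.logLaw PX μ ρ) w).toNNReal) := by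
  set z : ℕ → Ω → SlateOPE.Obs 𝒳 d := fun i ω => ((X i ω, A i ω), R i ω) with hz
  set D := SlateOPE.logLaw PX μ ρ with hD
  have hYint k : Integrable (SlateOPE.Y π μs k) D := (hY k).integrable one_le_two
  have hYmean k : ∫ x, SlateOPE.Y π μs k x ∂D = 1 := SlateOPE.integral_Y hfac hcov (hYint k)
  have hGmean : ∫ x, SlateOPE.Gam π μs w x ∂D = SlateOPE.theta π μs D :=
    SlateOPE.integral_Gam hYint (hGR.integrable one_le_two) hYmean w
  have hclt := SlateOPE.tendstoInDistribution_empMean hindep hlaw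
    (SlateOPE.measurable_Gam π μs w) (SlateOPE.memLp_Gam hY hGR w)
  have hcltY k := SlateOPE.tendstoInDistribution_empMean hindep hlaw
    (SlateOPE.measurable_Y π μs k) (hY k)
  simp only [hGmean] at hclt
  simp only [hYmean] at hcltY
  have hΔm (k : Fin K) (n : ℕ) : AEMeasurable (fun ω => w k - what n ω k) P :=
    aemeasurable_const.sub ((measurable_pi_apply k).comp_aemeasurable (hwhat n))
  have hsum := hclt.add_sum_of_tendstoInMeasure_zero Finset.univ
    (fun k => (hcltY k).mul_tendstoInMeasure_zero (hw.apply_sub k) (hΔm k))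
    (fun k n => ((hcltY k).forall_aemeasurable n).mul (hΔm k n))
  refine hsum.congr (fun n => ae_of_all _ fun ω => ?_) (ae_eq_refl _)
  -- The weight-change identity can fail at `n = 0`, where empirical means are 0 by convention;
  -- there the factor √0 kills both sides.
  rcases Nat.eq_zero_or_pos n with rfl | hn
  · simp
  · have h := SlateOPE.thetaHat_sub_thetaHat (π := π) (μs := μs) hn.ne' (fun i => z i ω) w
      (what n ω)
    simp only [mul_assoc, ← Finset.mul_sum, ← h]
    rw [SlateOPE.thetaHat, SlateOPE.thetaHat]
    ring
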